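/- Let $\mathcal V$ be the convex set of all nonnegative real arrays $V=(V_{nk})$, $n=1,2,\dots$, $0\le k\le n-1$, that satisfy $V_{10}=1$ and the dual Eulerian recursion $$V_{nk}=(k+1)V_{n+1,k}+(n-k)V_{n+1,k+1}\qquad(n\ge 1,\ 0\le k\le n-1),$$ equipped with the topology of pointwise convergence, and let $\mathrm{ex}(\mathcal V)$ be the set of its extreme points. Then every $W\in\mathrm{ex}(\mathcal V)$ is uniquely determined by the parameter $\theta:=W_{20}$, and the set of values of this parameter, as $W$ ranges over $\mathrm{ex}(\mathcal V)$, is exactly $$\Theta=\left\{\tfrac12\cdot\tfrac{\varkappa}{\varkappa+1}:\ \varkappa=0,1,\dots\right\}\cup\left\{\tfrac12\right\}\cup\left\{\tfrac12\cdot\tfrac{\varkappa+2}{\varkappa+1}:\ \varkappa=0,1,\dots\right\}\subset[0,1].$$ The map $W\mapsto W_{20}$ is a homeomorphism of $\mathrm{ex}(\mathcal V)$ onto $\Theta$, where $\Theta$ has the topology of a subset of $\mathbb R$. Moreover, $\tfrac12$ is the only accumulation point of $\Theta$ in $\mathbb R$, and the only accumulation point of $\mathrm{ex}(\mathcal V)$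 in the space of all real arrays is the element $W\in\mathrm{ex}(\mathcal V)$ with $W_{20}=\tfrac12$; thus all other points of $\mathrm{ex}(\mathcal V)$ are isolated. -/

import Mathlib

open Topology Filter

namespace EulerianTriangle

/-- The index set of the triangle: pairs `(n, k)` with `n ≥ 1` and `0 ≤ k ≤ n - 1`
(equivalently, natural numbers with `k < n`). -/
@[ext]
structure Vertex where
  n : ℕ
  k : ℕ
  lt : k < n

/-- Real arrays `V = (V_{nk})` indexed by the triangle, with the pointwise vector space structure
and the topology of pointwise convergence (the product topology). -/
abbrev Arr : Type := Vertex → ℝ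

/-- The set `𝒱` of nonnegative normalized solutions of the dual Eulerian recursion
`V_{nk} = (k + 1) V_{n+1,k} + (n - k) V_{n+1,k+1}`, `V_{10} = 1`. -/
def solutions : Set Arr :=
  {V | (∀ v, 0 ≤ V v) ∧
    V ⟨1, 0, Nat.one_pos⟩ = 1 ∧
    ∀ (n k : ℕ) (h : k < n),
      V ⟨n, k, h⟩ = ((k : ℝ) + 1) * V ⟨n + 1, k, Nat.lt_succ_of_lt h⟩
        + ((n : ℝ) - (k : ℝ)) * V ⟨n + 1, k + 1, Nat.succ_lt_succ h⟩}

/-- The boundary `ex(𝒱)`: the extreme points of the set of solutions. -/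
def boundary : Set Arr := solutions.extremePoints ℝ

/-- The parameter `θ = W_{20}` of an array. -/
def theta (W : Arr) : ℝ := W ⟨2, 0, Nat.two_pos⟩

/-- The parameter set `Θ`. -/
def Theta : Set ℝ :=
  {t | ∃ κ : ℕ, t = 1 / 2 * ((κ : ℝ) / ((κ : ℝ) + 1))} ∪ {1 / 2} ∪
    {t | ∃ κ : ℕ, t = 1 / 2 * (((κ : ℝ) + 2) / ((κ : ℝ) + 1))}

end EulerianTriangle

namespace EulerianTriangle

open Finset

/-! The operator `diff` preserves the recursion, and `V ± diff V` is nonnegative whenever `V` is a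
nonnegative solution. An extreme `V` is the sum of `(V + diff V) / 2` and `(V - diff V) / 2`, so
both are multiples of `V`: `V` is an eigenvector of `diff`, with eigenvalue `x = 2θ - 1`. The
eigenvector equation and the recursion together determine `V` step by step, which gives the explicit
product `eigenArr x`. Its nonnegativity on the two edges of the triangle forces `x = 0` or `x =
±1/m`.

Conversely, for each such `x` a linear functional is maximized over the compact set `solutions`. Its
maximal face has an extreme point, necessarily some `eigenArr y`, and comparing values gives `y =
x`. The topological claims follow because `theta` and `eigenArr` are continuous and `Theta` is
closed. -/

/-- The difference operator `V ↦ (V_{n+1,k} - V_{n+1,k+1})`. -/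
def diff (V : Arr) : Arr := fun v =>
  V ⟨v.n + 1, v.k, Nat.lt_succ_of_lt v.lt⟩ - V ⟨v.n + 1, v.k + 1, Nat.succ_lt_succ v.lt⟩

/-- The dual Eulerian recursion. -/
def IsHarmonic (V : Arr) : Prop :=
  ∀ (n k : ℕ) (h : k < n),
    V ⟨n, k, h⟩ = ((k : ℝ) + 1) * V ⟨n + 1, k, Nat.lt_succ_of_lt h⟩
      + ((n : ℝ) - (k : ℝ)) * V ⟨n + 1, k + 1, Nat.succ_lt_succ h⟩

/-- The normalized common eigenvector of the difference operator and the recursion. -/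
noncomputable def eigenArr (x : ℝ) : Arr := fun v =>
  (∏ i ∈ range (v.n - 1 - v.k), (1 + ((i : ℝ) + 1) * x)) *
    (∏ j ∈ range v.k, (1 - ((j : ℝ) + 1) * x)) / (v.n.factorial : ℝ)

/-- The spectrum `{0} ∪ {±1/m}` of the difference operator. -/
def spec : Set ℝ := {x | x = 0 ∨ ∃ m : ℕ, x = 1 / ((m : ℝ) + 1) ∨ x = -(1 / ((m : ℝ) + 1))}

/-! ### Harmonic arrays and compactness -/

lemma IsHarmonic.diff {V : Arr} (hV : IsHarmonic V) : IsHarmonic (diff V) := by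
  intro n k h
  have h1 := hV (n + 1) k (Nat.lt_succ_of_lt h)
  have h2 := hV (n + 1) (k + 1) (Nat.succ_lt_succ h)
  simp only [EulerianTriangle.diff]
  rw [h1, h2]
  push_cast
  ring

lemma IsHarmonic.combination {V W : Arr} (hV : IsHarmonic V) (hW : IsHarmonic W) (a b : ℝ) :
    IsHarmonic (a • V + b • W) := by
  intro n k h
  simp only [Pi.add_apply, Pi.smul_apply, smul_eq_mul]
  rw [hV n k h, hW n k h]
  ring

lemma IsHarmonic.step_le {V : Arr} (hV : IsHarmonic V) (h0 : ∀ v, 0 ≤ V v) {n k : ℕ} (h : k < n) :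
    V ⟨n + 1, k, Nat.lt_succ_of_lt h⟩ ≤ V ⟨n, k, h⟩ ∧
      V ⟨n + 1, k + 1, Nat.succ_lt_succ h⟩ ≤ V ⟨n, k, h⟩ := by
  have h1 := h0 ⟨n + 1, k, Nat.lt_succ_of_lt h⟩
  have h2 := h0 ⟨n + 1, k + 1, Nat.succ_lt_succ h⟩
  have hk : (0 : ℝ) ≤ k := Nat.cast_nonneg k
  have hn : (1 : ℝ) ≤ n - k := by
    have : ((k + 1 : ℕ) : ℝ) ≤ n := Nat.cast_le.mpr h
    push_cast at this
    linarith
  rw [hV n k h]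
  constructor <;> nlinarith [mul_nonneg hk h1]

/-- Induction along the edges of the triangle. -/
lemma vertex_induction {P : Vertex → Prop} (base : P ⟨1, 0, Nat.one_pos⟩)
    (left : ∀ n k h, P ⟨n, k, h⟩ → P ⟨n + 1, k, Nat.lt_succ_of_lt h⟩)
    (right : ∀ n k h, P ⟨n, k, h⟩ → P ⟨n + 1, k + 1, Nat.succ_lt_succ h⟩) (v : Vertex) : P v := by
  obtain ⟨n, k, h⟩ := v
  induction n generalizing k with
  | zero => omega
  | succ n ih =>
    by_cases hk : k < n
    · exact left n k hk (ih k hk)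
    · cases k with
      | zero =>
        obtain rfl : n = 0 := by omega
        exact base
      | succ k => exact right n k (by omega) (ih k (by omega))

lemma IsHarmonic.le_root {V : Arr} (hV : IsHarmonic V) (h0 : ∀ v, 0 ≤ V v) (v : Vertex) :
    V v ≤ V ⟨1, 0, Nat.one_pos⟩ := by
  induction v using vertex_induction with
  | base => exact le_rfl
  | left n k h ih => exact (hV.step_le h0 h).1.trans ih
  | right n k h ih => exact (hV.step_le h0 h).2.trans ih

lemma isCompact_solutions : IsCompact solutions := by
  have hsub : solutions ⊆ Set.univ.pi fun _ : Vertex => Set.Icc (0 : ℝ) 1 := fun V hV v _ =>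
    ⟨hV.1 v, (IsHarmonic.le_root hV.2.2 hV.1 v).trans_eq hV.2.1⟩
  refine (isCompact_univ_pi fun _ => isCompact_Icc).of_isClosed_subset ?_ hsub
  have h1 : IsClosed {V : Arr | ∀ v, 0 ≤ V v} := by
    simp only [Set.ofPred_forall]
    exact isClosed_iInter fun v => isClosed_le continuous_const (continuous_apply v)
  have h2 : IsClosed {V : Arr | V ⟨1, 0, Nat.one_pos⟩ = 1} :=
    isClosed_eq (continuous_apply _) continuous_const
  have h3 : IsClosed {V : Arr | IsHarmonic V} := by
    simp only [IsHarmonic, Set.ofPred_forall]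
    refine isClosed_iInter fun n => isClosed_iInter fun k => isClosed_iInter fun h => ?_
    exact isClosed_eq (by fun_prop) (by fun_prop)
  exact h1.inter (h2.inter h3)

/-! ### Extreme solutions are eigenvectors of the difference operator -/

/-- A nonnegative solution dominated by an extreme one is proportional to it. -/
lemma eq_smul_of_mem_boundary {V A B : Arr} (hV : V ∈ boundary) (hA : IsHarmonic A)
    (hB : IsHarmonic B) (hA0 : ∀ v, 0 ≤ A v) (hB0 : ∀ v, 0 ≤ B v) (hAB : A + B = V) :
    A = A ⟨1, 0, Nat.one_pos⟩ • V := by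
  have hroot : A ⟨1, 0, Nat.one_pos⟩ + B ⟨1, 0, Nat.one_pos⟩ = 1 := by
    rw [← hV.1.2.1, ← hAB]; rfl
  have vanish {C : Arr} (hC : IsHarmonic C) (hC0 : ∀ v, 0 ≤ C v)
      (h : C ⟨1, 0, Nat.one_pos⟩ = 0) : C = 0 := by
    funext v
    exact le_antisymm ((hC.le_root hC0 v).trans_eq h) (hC0 v)
  set a := A ⟨1, 0, Nat.one_pos⟩
  set b := B ⟨1, 0, Nat.one_pos⟩
  rcases (hA0 ⟨1, 0, Nat.one_pos⟩).eq_or_lt with h | hapos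
  · rw [vanish hA hA0 h.symm, show a = 0 from h.symm, zero_smul]
  rcases (hB0 ⟨1, 0, Nat.one_pos⟩).eq_or_lt with h | hbpos
  · have hb0 : b = 0 := h.symm
    have ha1 : a = 1 := by linarith
    rw [← hAB, vanish hB hB0 h.symm, ha1, add_zero, one_smul]
  have normalize {C : Arr} (hC : IsHarmonic C) (hC0 : ∀ v, 0 ≤ C v)
      (h : 0 < C ⟨1, 0, Nat.one_pos⟩) : (C ⟨1, 0, Nat.one_pos⟩)⁻¹ • C ∈ solutions := by
    refine ⟨fun v => mul_nonneg (inv_nonneg.mpr h.le) (hC0 v), inv_mul_cancel₀ h.ne', ?_⟩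
    have := hC.combination hC (C ⟨1, 0, Nat.one_pos⟩)⁻¹ 0
    rwa [zero_smul, add_zero] at this
  have key : a⁻¹ • A = V := by
    refine hV.2 (normalize hA hA0 hapos) (normalize hB hB0 hbpos)
      ⟨a, b, hapos, hbpos, hroot, ?_⟩
    rw [smul_inv_smul₀ hapos.ne', smul_inv_smul₀ hbpos.ne', hAB]
  rw [← key, smul_inv_smul₀ hapos.ne']

lemma theta_eq {V : Arr} (hV : V ∈ solutions) :
    V ⟨2, 1, Nat.one_lt_two⟩ = 1 - theta V := by
  have h := hV.2.2 1 0 Nat.one_pos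
  rw [hV.2.1] at h
  simp only [theta]
  norm_num at h
  linarith

lemma diff_eq_smul {V : Arr} (hV : V ∈ boundary) : diff V = (2 * theta V - 1) • V := by
  have hH : IsHarmonic V := hV.1.2.2
  have h0 := hV.1.1
  have hA := hH.combination hH.diff (1 / 2) (1 / 2)
  have hB := hH.combination hH.diff (1 / 2) (-1 / 2)
  have bounds : ∀ v, 0 ≤ V v + diff V v ∧ 0 ≤ V v - diff V v := by
    rintro ⟨n, k, h⟩
    have h1 := h0 ⟨n + 1, k, Nat.lt_succ_of_lt h⟩
    have h2 := h0 ⟨n + 1, k + 1, Nat.succ_lt_succ h⟩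
    have hk : (0 : ℝ) ≤ k := Nat.cast_nonneg k
    have hn : (0 : ℝ) ≤ n - k - 1 := by
      have : ((k + 1 : ℕ) : ℝ) ≤ n := Nat.cast_le.mpr h
      push_cast at this
      linarith
    simp only [diff]
    -- With `a`, `b` the entries at `(n+1, k)` and `(n+1, k+1)`, the two sums are `(k+2)a +
    -- (n-k-1)b` and `ka + (n-k+1)b`.
    rw [hH n k h]
    constructor <;> nlinarith [mul_nonneg hk h1, mul_nonneg hn h2]
  have hA0 : ∀ v, 0 ≤ ((1 / 2 : ℝ) • V + (1 / 2 : ℝ) • diff V) v := fun v => by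
    simp only [Pi.add_apply, Pi.smul_apply, smul_eq_mul]
    linarith [(bounds v).1]
  have hB0 : ∀ v, 0 ≤ ((1 / 2 : ℝ) • V + (-1 / 2 : ℝ) • diff V) v := fun v => by
    simp only [Pi.add_apply, Pi.smul_apply, smul_eq_mul]
    linarith [(bounds v).2]
  have key := eq_smul_of_mem_boundary hV hA hB hA0 hB0 (by module)
  have hmass : ((1 / 2 : ℝ) • V + (1 / 2 : ℝ) • diff V) ⟨1, 0, Nat.one_pos⟩ = theta V := by
    have h1 := theta_eq hV.1
    have h2 := hV.1.2.1
    simp only [Pi.add_apply, Pi.smul_apply, smul_eq_mul, diff]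
    simp only [zero_add, one_add_one_eq_two]
    rw [h1, h2, theta]
    ring
  rw [hmass] at key
  funext v
  have := congrFun key v
  simp only [Pi.add_apply, Pi.smul_apply, smul_eq_mul] at this ⊢
  linarith

/-! ### The explicit eigenvectors -/

lemma eigenArr_root (x : ℝ) : eigenArr x ⟨1, 0, Nat.one_pos⟩ = 1 := by
  simp [eigenArr]

lemma eigenArr_left (x : ℝ) {n k : ℕ} (h : k < n) :
    eigenArr x ⟨n + 1, k, Nat.lt_succ_of_lt h⟩ =
      (1 + ((n : ℝ) - k) * x) / (n + 1) * eigenArr x ⟨n, k, h⟩ := by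
  obtain ⟨d, rfl⟩ : ∃ d, n = k + 1 + d := ⟨n - (k + 1), by omega⟩
  have h1 : k + 1 + d + 1 - 1 - k = d + 1 := by omega
  have h2 : k + 1 + d - 1 - k = d := by omega
  have hf : ((k + 1 + d).factorial : ℝ) ≠ 0 := Nat.cast_ne_zero.mpr (Nat.factorial_ne_zero _)
  have hn : (((k + 1 + d : ℕ) : ℝ) + 1) ≠ 0 := by positivity
  simp only [eigenArr, h1, h2, prod_range_succ, Nat.factorial_succ]
  rw [Nat.cast_mul, Nat.cast_succ (k + 1 + d)]
  generalize ∏ i ∈ range d, (1 + ((i : ℝ) + 1) * x) = p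
  field_simp
  push_cast
  ring

lemma eigenArr_right (x : ℝ) {n k : ℕ} (h : k < n) :
    eigenArr x ⟨n + 1, k + 1, Nat.succ_lt_succ h⟩ =
      (1 - ((k : ℝ) + 1) * x) / (n + 1) * eigenArr x ⟨n, k, h⟩ := by
  have h1 : n + 1 - 1 - (k + 1) = n - 1 - k := by omega
  have hf : (n.factorial : ℝ) ≠ 0 := Nat.cast_ne_zero.mpr (Nat.factorial_ne_zero _)
  have hn : ((n : ℝ) + 1) ≠ 0 := by positivity
  simp only [eigenArr, h1, prod_range_succ, Nat.factorial_succ]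
  rw [Nat.cast_mul, Nat.cast_succ n]
  generalize ∏ i ∈ range (n - 1 - k), (1 + ((i : ℝ) + 1) * x) = p
  generalize ∏ j ∈ range k, (1 - ((j : ℝ) + 1) * x) = q
  field_simp

lemma isHarmonic_eigenArr (x : ℝ) : IsHarmonic (eigenArr x) := by
  intro n k h
  rw [eigenArr_left x h, eigenArr_right x h]
  have hn : ((n : ℝ) + 1) ≠ 0 := by positivity
  field_simp
  ring

/-- The recursion and the eigenvector equation form a linear system of determinant `-(n+1)` in the
two entries below `(n, k)`, so the root value determines everything. -/
lemma eq_eigenArr {V : Arr} {x : ℝ} (hV : V ∈ solutions) (hx : diff V = x • V) :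
    V = eigenArr x := by
  funext v
  have steps : ∀ n k h, V ⟨n + 1, k, Nat.lt_succ_of_lt h⟩ =
        (1 + ((n : ℝ) - k) * x) / (n + 1) * V ⟨n, k, h⟩ ∧
      V ⟨n + 1, k + 1, Nat.succ_lt_succ h⟩ =
        (1 - ((k : ℝ) + 1) * x) / (n + 1) * V ⟨n, k, h⟩ := by
    intro n k h
    have h1 := hV.2.2 n k h
    have h2 := congrFun hx ⟨n, k, h⟩
    simp only [diff, Pi.smul_apply, smul_eq_mul] at h2
    have hn : ((n : ℝ) + 1) ≠ 0 := by positivity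
    constructor
    · field_simp
      linear_combination (n - k) * h2 - h1
    · field_simp
      linear_combination -(k + 1) * h2 - h1
  induction v using vertex_induction with
  | base => rw [hV.2.1, eigenArr_root]
  | left n k h ih => rw [(steps n k h).1, ih, eigenArr_left]
  | right n k h ih => rw [(steps n k h).2, ih, eigenArr_right]

/-- If no factor vanished, all partial products, hence all factors, would be positive; but the
factors tend to `-∞`. -/
lemma exists_eq_one_div_of_prod_nonneg {x : ℝ} (hx : 0 < x)
    (h : ∀ n : ℕ, 0 ≤ ∏ j ∈ range n, (1 - ((j : ℝ) + 1) * x)) :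
    ∃ m : ℕ, x = 1 / ((m : ℝ) + 1) := by
  by_contra! hne
  have hfac : ∀ j : ℕ, 1 - ((j : ℝ) + 1) * x ≠ 0 := by
    intro j hj
    refine hne j ?_
    rw [eq_div_iff (by positivity)]
    linarith
  have hpos : ∀ n : ℕ, 0 < ∏ j ∈ range n, (1 - ((j : ℝ) + 1) * x) := fun n =>
    lt_of_le_of_ne (h n) (Ne.symm (prod_ne_zero_iff.mpr fun j _ => hfac j))
  obtain ⟨n, hn⟩ := exists_nat_gt (1 / x)
  rw [div_lt_iff₀ hx] at hn
  have h1 := hpos (n + 1)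
  rw [prod_range_succ] at h1
  have := pos_of_mul_pos_right h1 (hpos n).le
  linarith

lemma mem_spec_of_nonneg {x : ℝ} (h : ∀ v, 0 ≤ eigenArr x v) : x ∈ spec := by
  have hf : ∀ n : ℕ, (0 : ℝ) < n.factorial := fun n => Nat.cast_pos.mpr n.factorial_pos
  rcases lt_trichotomy x 0 with hx | hx | hx
  · obtain ⟨m, hm⟩ := exists_eq_one_div_of_prod_nonneg (neg_pos.mpr hx) fun n => by
      -- On an edge of the triangle only one of the two products survives.
      have := h ⟨n + 1, 0, n.succ_pos⟩
      simp only [eigenArr] at this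
      rw [le_div_iff₀ (hf _)] at this
      simpa [sub_neg_eq_add] using this
    exact Or.inr ⟨m, Or.inr (by linarith)⟩
  · exact Or.inl hx
  · obtain ⟨m, hm⟩ := exists_eq_one_div_of_prod_nonneg hx fun n => by
      have := h ⟨n + 1, n, n.lt_succ_self⟩
      simp only [eigenArr] at this
      rw [le_div_iff₀ (hf _)] at this
      simpa using this
    exact Or.inr ⟨m, Or.inl hm⟩

lemma prod_nonneg_of_eq_one_div (m n : ℕ) :
    0 ≤ ∏ j ∈ range n, (1 - ((j : ℝ) + 1) * (1 / ((m : ℝ) + 1))) := by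
  by_cases hmn : m < n
  · refine (prod_eq_zero (mem_range.mpr hmn) ?_).ge
    have : ((m : ℝ) + 1) ≠ 0 := by positivity
    field_simp
    simp
  · refine prod_nonneg fun j hj => ?_
    have hj : ((j : ℝ) + 1) ≤ m + 1 := by
      have : j ≤ m := by have := mem_range.mp hj; omega
      have : (j : ℝ) ≤ m := Nat.cast_le.mpr this
      linarith
    rw [mul_one_div, sub_nonneg]
    exact (div_le_one (by positivity)).mpr hj

lemma eigenArr_nonneg {x : ℝ} (hx : x ∈ spec) (v : Vertex) : 0 ≤ eigenArr x v := by
  refine div_nonneg (mul_nonneg ?_ ?_) (Nat.cast_nonneg _)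
  · rcases hx with rfl | ⟨m, rfl | rfl⟩
    · simp
    · exact prod_nonneg fun _ _ => by positivity
    · simpa only [mul_neg, ← sub_eq_add_neg] using prod_nonneg_of_eq_one_div m _
  · rcases hx with rfl | ⟨m, rfl | rfl⟩
    · simp
    · exact prod_nonneg_of_eq_one_div m _
    · refine prod_nonneg fun _ _ => ?_
      rw [mul_neg, sub_neg_eq_add]
      positivity

lemma eigenArr_mem_solutions {x : ℝ} (hx : x ∈ spec) : eigenArr x ∈ solutions :=
  ⟨eigenArr_nonneg hx, eigenArr_root x, isHarmonic_eigenArr x⟩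

lemma theta_eigenArr (x : ℝ) : theta (eigenArr x) = (1 + x) / 2 := by
  simp [theta, eigenArr]

lemma eigenArr_three_one (x : ℝ) : eigenArr x ⟨3, 1, by norm_num⟩ = (1 - x ^ 2) / 6 := by
  simp [eigenArr, Nat.factorial]
  ring

lemma boundary_subset {V : Arr} (hV : V ∈ boundary) :
    2 * theta V - 1 ∈ spec ∧ V = eigenArr (2 * theta V - 1) := by
  have h := eq_eigenArr hV.1 (diff_eq_smul hV)
  exact ⟨mem_spec_of_nonneg fun v => h ▸ hV.1.1 v, h⟩

/-! ### Extremality of the eigenvectors -/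

/-- `eigenArr x` is exposed by a functional equal to `y ↦ 2xy - y²`, up to a constant, at
`eigenArr y`. -/
lemma eigenArr_mem_boundary {x : ℝ} (hx : x ∈ spec) : eigenArr x ∈ boundary := by
  let l : StrongDual ℝ Arr :=
    (6 : ℝ) • ContinuousLinearMap.proj (R := ℝ) (φ := fun _ : Vertex => ℝ) ⟨3, 1, by norm_num⟩ +
      (4 * x) • ContinuousLinearMap.proj (R := ℝ) (φ := fun _ : Vertex => ℝ) ⟨2, 0, Nat.two_pos⟩
  have hl : ∀ y, l (eigenArr y) = 1 + 2 * x + 2 * x * y - y ^ 2 := by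
    intro y
    have h1 := eigenArr_three_one y
    have h2 := theta_eigenArr y
    rw [theta] at h2
    change 6 * eigenArr y _ + 4 * x * eigenArr y _ = _
    rw [h1, h2]
    ring
  have hexp : IsExposed ℝ solutions (l.toExposed solutions) :=
    ContinuousLinearMap.toExposed.isExposed
  have hne : (l.toExposed solutions).Nonempty := by
    obtain ⟨V, hV, hmax⟩ := isCompact_solutions.exists_isMaxOn ⟨_, eigenArr_mem_solutions hx⟩
      l.continuous.continuousOn
    exact ⟨V, hV, fun W hW => hmax hW⟩
  -- An extreme point of the exposed face is extreme in `solutions`, hence some `eigenArr y`;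
  -- maximality then reads `(y - x)² ≤ 0`.
  obtain ⟨V, hV⟩ := (hexp.isCompact isCompact_solutions).extremePoints_nonempty hne
  have hVb : V ∈ boundary := hexp.isExtreme.extremePoints_subset_extremePoints hV
  obtain ⟨-, hVe⟩ := boundary_subset hVb
  have hmax := hV.1.2 _ (eigenArr_mem_solutions hx)
  rw [hVe, hl, hl] at hmax
  have hxy : 2 * theta V - 1 = x := by
    have : (2 * theta V - 1 - x) ^ 2 ≤ 0 := by linarith
    have := pow_eq_zero_iff (two_ne_zero) |>.mp (le_antisymm this (sq_nonneg _))
    linarith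
  rwa [← hxy, ← hVe]

/-! ### Topology of the parameter set and of the boundary -/

lemma mem_Theta_iff {t : ℝ} : t ∈ Theta ↔ 2 * t - 1 ∈ spec := by
  have key : ∀ κ : ℕ, (t = 1 / 2 * ((κ : ℝ) / ((κ : ℝ) + 1)) ↔ 2 * t - 1 = -(1 / ((κ : ℝ) + 1))) ∧
      (t = 1 / 2 * (((κ : ℝ) + 2) / ((κ : ℝ) + 1)) ↔ 2 * t - 1 = 1 / ((κ : ℝ) + 1)) := by
    intro κ
    have hκ : ((κ : ℝ) + 1) ≠ 0 := by positivity
    have h1 : (κ : ℝ) / ((κ : ℝ) + 1) = 1 - 1 / ((κ : ℝ) + 1) := by field_simp; ring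
    have h2 : ((κ : ℝ) + 2) / ((κ : ℝ) + 1) = 1 + 1 / ((κ : ℝ) + 1) := by field_simp; ring
    rw [h1, h2]
    refine ⟨⟨fun h => ?_, fun h => ?_⟩, ⟨fun h => ?_, fun h => ?_⟩⟩ <;> linarith
  have hz : t = 1 / 2 ↔ 2 * t - 1 = 0 := ⟨fun h => by linarith, fun h => by linarith⟩
  simp only [Theta, spec, Set.mem_union, Set.mem_ofPred_eq, Set.mem_singleton_iff, hz,
    fun κ => (key κ).1, fun κ => (key κ).2, exists_or]
  tauto

lemma eigenArr_mem_boundary_of_mem_Theta {t : ℝ} (ht : t ∈ Theta) :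
    eigenArr (2 * t - 1) ∈ boundary := eigenArr_mem_boundary (mem_Theta_iff.mp ht)

lemma theta_mem_Theta {W : Arr} (hW : W ∈ boundary) : theta W ∈ Theta :=
  mem_Theta_iff.mpr (boundary_subset hW).1

lemma theta_eigenArr_two_mul_sub_one (t : ℝ) : theta (eigenArr (2 * t - 1)) = t := by
  rw [theta_eigenArr]; ring

@[fun_prop]
lemma continuous_theta : Continuous theta := continuous_apply _

@[fun_prop]
lemma continuous_eigenArr : Continuous eigenArr := by
  refine continuous_pi fun v => ?_
  simp only [eigenArr]
  fun_prop

lemma finite_spec_of_pos {ε : ℝ} (hε : 0 < ε) : {x ∈ spec | ε < |x|}.Finite := by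
  obtain ⟨N, hN⟩ := exists_nat_gt (1 / ε)
  rw [div_lt_iff₀ hε] at hN
  refine (((range N).finite_toSet.image fun m : ℕ => 1 / ((m : ℝ) + 1)).union
    ((range N).finite_toSet.image fun m : ℕ => -(1 / ((m : ℝ) + 1)))).subset ?_
  have small : ∀ m : ℕ, ε < 1 / ((m : ℝ) + 1) → m ∈ (range N : Set ℕ) := by
    intro m hm
    rw [lt_div_iff₀ (by positivity)] at hm
    have : (m : ℝ) < N := by
      by_contra! h
      nlinarith
    simpa using this
  rintro x ⟨hx, hεx⟩
  have habs : ∀ m : ℕ, |1 / ((m : ℝ) + 1)| = 1 / ((m : ℝ) + 1) := fun m =>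
    abs_of_pos (by positivity)
  rcases hx with rfl | ⟨m, rfl | rfl⟩
  · rw [abs_zero] at hεx
    exact absurd hεx hε.not_gt
  · rw [habs] at hεx
    exact Or.inl ⟨m, small m hεx, rfl⟩
  · rw [abs_neg, habs] at hεx
    exact Or.inr ⟨m, small m hεx, rfl⟩

lemma accPt_Theta_iff (t : ℝ) : AccPt t (𝓟 Theta) ↔ t = 1 / 2 := by
  constructor
  · intro h
    by_contra hne
    have hx : 0 < |2 * t - 1| := abs_pos.mpr fun h => hne (by linarith)
    have hU : {s : ℝ | |2 * t - 1| / 2 < |2 * s - 1|} ∈ 𝓝 t :=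
      (isOpen_lt (by fun_prop) (by fun_prop)).mem_nhds (by simpa using hx)
    refine Set.Infinite.of_accPt (h.nhds_inter hU) ?_
    refine ((finite_spec_of_pos (half_pos hx)).preimage
      (f := fun s : ℝ => 2 * s - 1) (fun a _ b _ hab => by simpa using hab)).subset ?_
    exact fun s hs => ⟨mem_Theta_iff.mp hs.2, hs.1⟩
  · rintro rfl
    rw [accPt_iff_frequently]
    have hlim : Tendsto (fun m : ℕ => 1 / 2 + 1 / ((m : ℝ) + 1) / 2) atTop (𝓝 (1 / 2)) := by
      have := (tendsto_one_div_add_atTop_nhds_zero_nat (𝕜 := ℝ)).div_const 2 |>.const_add (1 / 2)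
      rwa [zero_div, add_zero] at this
    refine hlim.frequently (Eventually.frequently (Eventually.of_forall fun m => ⟨?_, ?_⟩))
    · have : (0 : ℝ) < 1 / ((m : ℝ) + 1) / 2 := by positivity
      linarith
    · refine mem_Theta_iff.mpr (Or.inr ⟨m, Or.inl ?_⟩)
      ring

lemma isClosed_Theta : IsClosed Theta := by
  rw [isClosed_iff_derivedSet_subset]
  intro t ht
  rw [mem_derivedSet, accPt_Theta_iff] at ht
  exact Or.inl (Or.inr ht)

/-- Closedness places every accumulation point in the space of all arrays inside `boundary`, where
`theta` is injective. -/
lemma isClosed_boundary : IsClosed boundary := by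
  have h : boundary = theta ⁻¹' Theta ∩ {V | V = eigenArr (2 * theta V - 1)} := by
    ext V
    refine ⟨fun hV => ⟨theta_mem_Theta hV, (boundary_subset hV).2⟩, fun hV => ?_⟩
    rw [hV.2]
    exact eigenArr_mem_boundary_of_mem_Theta hV.1
  rw [h]
  exact (isClosed_Theta.preimage continuous_theta).inter
    (isClosed_eq continuous_id (by fun_prop))

lemma theta_injOn_boundary : Set.InjOn theta boundary := fun W hW W' hW' h => by
  rw [(boundary_subset hW).2, (boundary_subset hW').2, h]

/-- The parametrization of the boundary by `θ`. -/
noncomputable def boundaryHomeomorph : boundary ≃ₜ Theta where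
  toFun W := ⟨theta W, theta_mem_Theta W.2⟩
  invFun t := ⟨eigenArr (2 * t - 1), eigenArr_mem_boundary_of_mem_Theta t.2⟩
  left_inv W := Subtype.ext (boundary_subset W.2).2.symm
  right_inv t := Subtype.ext (theta_eigenArr_two_mul_sub_one t)
  continuous_toFun := by fun_prop
  continuous_invFun := by fun_prop

lemma accPt_boundary_iff (W : Arr) :
    AccPt W (𝓟 boundary) ↔ W ∈ boundary ∧ theta W = 1 / 2 := by
  constructor
  · intro h
    have hW : W ∈ boundary := isClosed_iff_derivedSet_subset _ |>.mp isClosed_boundary h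
    refine ⟨hW, (accPt_Theta_iff _).mp ?_⟩
    rw [accPt_iff_frequently] at h ⊢
    refine (continuous_theta.tendsto W).frequently (h.mono fun V hV => ?_)
    exact ⟨fun heq => hV.1 (theta_injOn_boundary hV.2 hW heq), theta_mem_Theta hV.2⟩
  · rintro ⟨hW, hθ⟩
    have h := (accPt_Theta_iff (theta W)).mpr hθ
    rw [accPt_iff_frequently] at h ⊢
    have hc : Tendsto (fun t : ℝ => eigenArr (2 * t - 1)) (𝓝 (theta W)) (𝓝 W) := by
      have : Continuous fun t : ℝ => eigenArr (2 * t - 1) := by fun_prop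
      simpa only [← (boundary_subset hW).2] using this.tendsto (theta W)
    refine hc.frequently (h.mono fun t ht => ⟨fun heq => ht.1 ?_,
      eigenArr_mem_boundary_of_mem_Theta ht.2⟩)
    rw [← heq, theta_eigenArr_two_mul_sub_one]

end EulerianTriangle

theorem theorem1 :
    -- an extreme solution is uniquely determined by its parameter `θ = W_{20}`
    (∀ W ∈ EulerianTriangle.boundary, ∀ W' ∈ EulerianTriangle.boundary,
      EulerianTriangle.theta W = EulerianTriangle.theta W' → W = W') ∧
    -- the set of values of the parameter is exactly `Θ`
    EulerianTriangle.theta '' EulerianTriangle.boundary = EulerianTriangle.Theta ∧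
    -- the correspondence `W ↦ W_{20}` is a homeomorphism of `ex(𝒱)` onto `Θ`
    (∃ e : EulerianTriangle.boundary ≃ₜ EulerianTriangle.Theta,
      ∀ W : EulerianTriangle.boundary, (e W : ℝ) = EulerianTriangle.theta (W : EulerianTriangle.Arr)) ∧
    -- `1/2` is the one and only accumulation point of `Θ`
    (∀ t : ℝ, AccPt t (𝓟 EulerianTriangle.Theta) ↔ t = 1 / 2) ∧
    -- the one and only accumulation point of the boundary is its element with parameter `1/2`
    (∀ W : EulerianTriangle.Arr, AccPt W (𝓟 EulerianTriangle.boundary) ↔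
      W ∈ EulerianTriangle.boundary ∧ EulerianTriangle.theta W = 1 / 2) := by
  open EulerianTriangle in
  refine ⟨theta_injOn_boundary, ?_, ⟨boundaryHomeomorph, fun _ => rfl⟩, accPt_Theta_iff,
    accPt_boundary_iff⟩
  refine Set.Subset.antisymm (Set.image_subset_iff.mpr fun W hW =>
    EulerianTriangle.theta_mem_Theta hW) fun t ht => ?_
  exact ⟨_, EulerianTriangle.eigenArr_mem_boundary_of_mem_Theta ht,
    EulerianTriangle.theta_eigenArr_two_mul_sub_one t⟩
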